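/- Setting. Consider an episodic Markov decision process with horizon $H\ge 1$, state space $\mathcal S$, action space $\mathcal A$, transition kernel $P$, reward kernel $R$, fixed initial state $s_1$, and pairwise disjoint sets of states $\mathcal S_1,\dots,\mathcal S_H\subseteq\mathcal S$, where $s_1\in\mathcal S_1$, a step from a state of $\mathcal S_h$ ($h<H$) leads to $\mathcal S_{h+1}$, and rewards lie in $[-1,1]$ almost surely. Let $\pi:\mathcal S\to\mathcal A$ be a deterministic policy with $Q$-functions $Q^\pi_h(s,a)=\mathbb E[\sum_{h'=h}^H r_{h'}\mid s_h=s,a_h=a,\pi]$, and let $\phi:\mathcal S\times\mathcal A\to\mathbb R^d$ ($d\ge 1$) be a feature map with $\|\phi(s,a)\|_2\le 1$ for all $(s,a)$. Let $\mu_h$ be a probability distribution on $\mathcal S_h\times\mathcal A$ for each $h\in\{1,\dots,H\}$, and let $N\ge 1$. For each $h$ a dataset of $N$ i.i.d. samples $(s_h^i,a_h^i,r_h^i,\overline s_h^i)$ is given, with $(s_h^i,a_h^i)\sim\mu_h$, $r_h^i\sim R(s_h^i,a_h^i)$, $\overline s_h^i\sim P(s_h^i,a_h^i)$. Least-Squares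 Policy Evaluation with parameter $\lambda>0$ sets $\hat V_{H+1}=0$ and, for $h=H,\dots,1$, $$\hat\Lambda_h=\sum_{i=1}^N\phi(s_h^i,a_h^i)\phi(s_h^i,a_h^i)^\top+\lambda I,\qquad \hat\theta_h=\hat\Lambda_h^{-1}\sum_{i=1}^N\phi(s_h^i,a_h^i)\bigl(r_h^i+\hat V_{h+1}(\overline s_h^i)\bigr),$$ $\hat Q_h(s,a)=\phi(s,a)^\top\hat\theta_h$ and $\hat V_h(s)=\hat Q_h(s,\pi(s))$. Let $\Lambda_h=\mathbb E_{(s,a)\sim\mu_h}[\phi(s,a)\phi(s,a)^\top]$, $\overline\Lambda_1=\phi(s_1,\pi(s_1))\phi(s_1,\pi(s_1))^\top$, and, for $1\le h<H$, $\overline\Lambda_{h+1}=\mathbb E_{(s,a)\sim\mu_h,\ \overline s\sim P(s,a)}[\phi(\overline s,\pi(\overline s))\phi(\overline s,\pi(\overline s))^\top]$. Theorem. For every $C>0$ there is a constant $c>0$, depending only on $C$, such that the following holds in every such setting and for every $\delta\in(0,1)$ with $dH/\delta\ge 2$ (this excludes only $d=H=1$, $\delta>1/2$). Suppose that for each $h\in\{1,\dots,H\}$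 there is $\theta_h\in\mathbb R^d$ with $\|\theta_h\|_2\le H\sqrt d$ and $Q^\pi_h(s,a)=\phi(s,a)^\top\theta_h$ for all $(s,a)\in\mathcal S_h\times\mathcal A$, and that for each $h\in\{1,\dots,H\}$ the number $C_h\ge 1$ satisfies $\overline\Lambda_h\preceq C_h\Lambda_h$. Let $\lambda=CH\sqrt{d\log(dH/\delta)\,N}$. Then with probability at least $1-\delta$, $$\bigl(Q^\pi_1(s_1,\pi(s_1))-\hat Q_1(s_1,\pi(s_1))\bigr)^2\le c\cdot\Bigl(\prod_{h=1}^H C_h\Bigr)\cdot dH^5\cdot\sqrt{\frac{d\log(dH/\delta)}{N}}.$$ -/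

import Mathlib

open MeasureTheory ProbabilityTheory
open scoped Matrix

universe u v w

namespace OfflineRL

/-- A finite-horizon Markov decision process on the state space `S` and the action space `A`, with
horizon `H`, fixed initial state `s₁`, transition kernel `P`, reward kernel `R` and disjoint sets of
states `level 1, …, level H`. Rewards lie in `[-1, 1]` almost surely. -/
structure MDP (S A : Type*) [MeasurableSpace S] [MeasurableSpace A] where
  /-- the planning horizon -/
  H : ℕ
  H_pos : 1 ≤ H
  /-- the transition operator -/
  P : Kernel (S × A) S
  markovP : IsMarkovKernel P
  /-- the reward distribution -/
  R : Kernel (S × A) ℝ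
  markovR : IsMarkovKernel R
  /-- the states at each level -/
  level : ℕ → Set S
  measurableSet_level : ∀ h ∈ Set.Icc 1 H, MeasurableSet (level h)
  level_disjoint : (Set.Icc 1 H).PairwiseDisjoint level
  /-- the initial state -/
  s₁ : S
  s₁_mem : s₁ ∈ level 1
  level_step : ∀ h, 1 ≤ h → h < H → ∀ s ∈ level h, ∀ a, ∀ᵐ s' ∂(P (s, a)), s' ∈ level (h + 1)
  reward_bound : ∀ h ∈ Set.Icc 1 H, ∀ s ∈ level h, ∀ a, ∀ᵐ r ∂(R (s, a)), r ∈ Set.Icc (-1 : ℝ) 1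

attribute [instance] MDP.markovP MDP.markovR

section

variable {S A : Type*} [MeasurableSpace S] [MeasurableSpace A]

namespace MDP

/-- The law of the trajectory `(s, a, r), (s', a', r'), …` of `k` steps that starts with the
state-action pair `(s, a)` and in which all later actions are chosen by the deterministic
policy `π`: the reward is drawn from `R (s, a)`, the next state `s'` from `P (s, a)`, and the rest
of the trajectory is a trajectory of `k - 1` steps that starts with `(s', π s')`. -/
noncomputable def trajLaw (M : MDP S A) (π : S → A) :
    (k : ℕ) → Kernel (S × A) (Fin k → (S × A) × ℝ)
  | 0 => Kernel.const _ (Measure.dirac Fin.elim0)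
  | k + 1 =>
    ((Kernel.id ×ₖ M.R) ×ₖ (trajLaw M π k ∘ₖ M.P.map (fun s' => (s', π s')))).map
      (fun p => (Fin.cons p.1 p.2 : Fin (k + 1) → (S × A) × ℝ))

/-- `Q_h^π(s, a) = E[∑_{h' = h}^H r_{h'} | s_h = s, a_h = a, π]`. -/
noncomputable def Q (M : MDP S A) (π : S → A) (h : ℕ) (s : S) (a : A) : ℝ :=
  ∫ τ, ∑ t, (τ t).2 ∂(M.trajLaw π (M.H + 1 - h) (s, a))

theorem measurable_cons {X : Type*} [MeasurableSpace X] (k : ℕ) :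
    Measurable (fun p : X × (Fin k → X) => (Fin.cons p.1 p.2 : Fin (k + 1) → X)) := by
  refine measurable_pi_iff.2 fun i => ?_
  refine Fin.cases ?_ (fun j => ?_) i
  · simpa using measurable_fst
  · simp only [Fin.cons_succ]
    fun_prop

theorem isMarkovKernel_trajLaw (M : MDP S A) {π : S → A} (hπ : Measurable π) (k : ℕ) :
    IsMarkovKernel (M.trajLaw π k) := by
  induction k with
  | zero => unfold trajLaw; infer_instance
  | succ k ih =>
    have h1 : IsMarkovKernel (M.P.map (fun s' => (s', π s'))) :=
      Kernel.IsMarkovKernel.map _ (by fun_prop)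
    unfold trajLaw
    exact Kernel.IsMarkovKernel.map _ (measurable_cons k)

end MDP

/-- A sample `((s, a), (r, s'))`. -/
abbrev Sample (S A : Type*) := (S × A) × (ℝ × S)

/-- The law of a sample: `(s, a) ∼ μ`, `r ∼ R (s, a)` and `s' ∼ P (s, a)`. -/
noncomputable def sampleLaw (M : MDP S A) (μ : Measure (S × A)) : Measure (Sample S A) :=
  μ ⊗ₘ (M.R ×ₖ M.P)

variable {d N : ℕ}

/-- `∑_i φ(s_i, a_i) φ(s_i, a_i)ᵀ + lam I`, the regularized empirical covariance of a dataset. -/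
noncomputable def empCov (φ : S → A → EuclideanSpace ℝ (Fin d)) (lam : ℝ)
    (D : Fin N → Sample S A) : Matrix (Fin d) (Fin d) ℝ :=
  ∑ i, Matrix.vecMulVec (φ (D i).1.1 (D i).1.2) (φ (D i).1.1 (D i).1.2) + lam • 1

/-- The estimates `θ̂_h` of Least-Squares Policy Evaluation, computed backwards from level `H`, where
`D h` is the dataset of level `h`. They are `0` above level `H`, so that `V̂_{H + 1} = 0`. -/
noncomputable def thetaHat (φ : S → A → EuclideanSpace ℝ (Fin d)) (π : S → A) (lam : ℝ) (H : ℕ)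
    (D : ℕ → Fin N → Sample S A) (h : ℕ) : EuclideanSpace ℝ (Fin d) :=
  if h ≤ H then
    WithLp.toLp 2 ((empCov φ lam (D h))⁻¹ *ᵥ
      (∑ i, ((D h i).2.1
          + inner ℝ (φ (D h i).2.2 (π (D h i).2.2)) (thetaHat φ π lam H D (h + 1))) •
        φ (D h i).1.1 (D h i).1.2).ofLp)
  else 0
termination_by H + 1 - h

/-- The estimate `Q̂_h(s, a) = φ(s, a)ᵀ θ̂_h` of Least-Squares Policy Evaluation. -/
noncomputable def QHat (φ : S → A → EuclideanSpace ℝ (Fin d)) (π : S → A) (lam : ℝ) (H : ℕ)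
    (D : ℕ → Fin N → Sample S A) (h : ℕ) (s : S) (a : A) : ℝ :=
  inner ℝ (φ s a) (thetaHat φ π lam H D h)

/-- `Λ = E_{(s, a) ∼ μ} [φ(s, a) φ(s, a)ᵀ]`. -/
noncomputable def featCov (φ : S → A → EuclideanSpace ℝ (Fin d)) (μ : Measure (S × A)) :
    Matrix (Fin d) (Fin d) ℝ :=
  Matrix.of fun i j => ∫ p, φ p.1 p.2 i * φ p.1 p.2 j ∂μ

/-- The covariance of the one-step lookahead distribution: at level `1` it is
`φ(s₁, π(s₁)) φ(s₁, π(s₁))ᵀ`, and at level `h + 1` with `h ≥ 1` it is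
`E [φ(s', π(s')) φ(s', π(s'))ᵀ]` for `(s, a) ∼ μ h` and `s' ∼ P (s, a)`. -/
noncomputable def lookaheadCov (M : MDP S A) (φ : S → A → EuclideanSpace ℝ (Fin d)) (π : S → A)
    (μ : ℕ → Measure (S × A)) (h : ℕ) : Matrix (Fin d) (Fin d) ℝ :=
  if h = 1 then Matrix.vecMulVec (φ M.s₁ (π M.s₁)) (φ M.s₁ (π M.s₁))
  else Matrix.of fun i j =>
    ∫ p, ∫ s', φ s' (π s') i * φ s' (π s') j ∂(M.P p) ∂(μ (h - 1))

end

end OfflineRL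

/-! The errors `z h = θ h - θ' h` of the estimates are measured in the norm of the regularized
empirical covariance (`energy`). By `sqrt_energy_sub_le`, the error at level `h` is at most the sum
of the ridge bias `√λ ‖θ h‖`, the noise term `‖∑ n_i φ_i‖ / √λ`, and the ℓ² norm over the samples of
the error of `V̂_{h+1}` at the next states. The noise is formed with the true `θ (h + 1)`, so the
Bellman equation makes it mean zero and no uniform bound over value functions is needed.

The third term is an empirical quadratic form of the lookahead features. Passing to its population
version, applying `Λ̄ ≼ C_{h+1} Λ` and returning to the empirical covariance of level `h + 1` costs
the factor `C_{h+1}` and two deviations `r ‖z‖²`. The ridge term absorbs these in a factor `1 +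
2r/λ`; since `λ` is at least of order `H r`, the product of `H` such factors is bounded by a
constant. Unrolling from level `H` (`lookahead_error_le`) leaves `(H a)²` with `a² ≲ λ H² d`, which
is `N` times the claimed rate.

Both kinds of fluctuation, of the noise vectors and of the matrices `φ φᵀ`, are controlled by one
dimension-free Hoeffding inequality in a Hilbert space (`measure_norm_sum_ge_le`). -/

namespace OfflineRL

/-! ### Hoeffding's inequality in a Hilbert space -/

section Concentration

/-- As a function of `u = x ^ 2`, `cosh x` is a power series with nonnegative coefficients, hence
convex and increasing on `u ≥ 0`. -/
theorem cosh_le_of_sq_le {x y z p q : ℝ} (hp : 0 ≤ p) (hq : 0 ≤ q) (hpq : p + q = 1)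
    (h : x ^ 2 ≤ p * y ^ 2 + q * z ^ 2) :
    Real.cosh x ≤ p * Real.cosh y + q * Real.cosh z := by
  refine hasSum_le (fun n => ?_) (Real.hasSum_cosh x)
    (((Real.hasSum_cosh y).mul_left p).add ((Real.hasSum_cosh z).mul_left q))
  have h1 : (x ^ 2) ^ n ≤ p * (y ^ 2) ^ n + q * (z ^ 2) ^ n := by
    refine (pow_le_pow_left₀ (sq_nonneg x) h n).trans ?_
    simpa using (convexOn_pow (𝕜 := ℝ) n).2 (sq_nonneg y) (sq_nonneg z) hp hq hpq
  rw [pow_mul, pow_mul, pow_mul, ← mul_div_assoc, ← mul_div_assoc, ← add_div]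
  gcongr

variable {E : Type*} [NormedAddCommGroup E] [InnerProductSpace ℝ E]

/-- The correction term is linear in `y`, so it averages out when `y` is centered and independent of
`x`; this makes `cosh (t * ‖·‖)` a substitute for the exponential moment. -/
theorem cosh_norm_add_le (t : ℝ) {b : ℝ} (hb : 0 < b) (x y : E) (hy : ‖y‖ ≤ b) :
    Real.cosh (t * ‖x + y‖) ≤ Real.cosh (t * ‖x‖) * Real.cosh (t * b)
      + inner ℝ ((Real.sinh (t * ‖x‖) / ‖x‖ * (Real.sinh (t * b) / b)) • x) y := by
  have hxy : |inner ℝ x y| ≤ ‖x‖ * b :=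
    (abs_real_inner_le_norm x y).trans (mul_le_mul_of_nonneg_left hy (norm_nonneg x))
  obtain ⟨s, hs, hs'⟩ : ∃ s : ℝ, |s| ≤ 1 ∧ inner ℝ x y = ‖x‖ * b * s ∧
      inner ℝ x y / (‖x‖ * b) = s := by
    refine ⟨inner ℝ x y / (‖x‖ * b), ?_, ?_, rfl⟩
    · rw [abs_div, abs_of_nonneg (by positivity : 0 ≤ ‖x‖ * b)]
      exact div_le_one_of_le₀ hxy (by positivity)
    · rcases eq_or_ne x 0 with rfl | hx
      · simp
      · have : ‖x‖ * b ≠ 0 := mul_ne_zero (norm_ne_zero_iff.2 hx) hb.ne'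
        field_simp
  -- With `s` the normalized inner product, `‖x‖² + 2‖x‖bs + b²` is the average of `(‖x‖ ± b)²` with
  -- weights `(1 ± s) / 2`.
  have key := cosh_le_of_sq_le (x := t * ‖x + y‖) (y := t * ‖x‖ + t * b) (z := t * ‖x‖ - t * b)
    (p := (1 + s) / 2) (q := (1 - s) / 2) (by linarith [(abs_le.1 hs).1])
    (by linarith [(abs_le.1 hs).2]) (by ring) (by
      have h1 : ‖x + y‖ ^ 2 ≤ ‖x‖ ^ 2 + 2 * (‖x‖ * b * s) + b ^ 2 := by
        rw [norm_add_sq_real, hs'.1]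
        gcongr
      calc (t * ‖x + y‖) ^ 2 = t ^ 2 * ‖x + y‖ ^ 2 := by ring
        _ ≤ t ^ 2 * (‖x‖ ^ 2 + 2 * (‖x‖ * b * s) + b ^ 2) := by gcongr
        _ = _ := by ring)
  refine key.trans (le_of_eq ?_)
  rw [real_inner_smul_left, Real.cosh_add, Real.cosh_sub]
  have : Real.sinh (t * ‖x‖) / ‖x‖ * (Real.sinh (t * b) / b) * inner ℝ x y
      = Real.sinh (t * ‖x‖) * Real.sinh (t * b) * s := by
    rw [← hs'.2]; ring
  rw [this]
  ring

variable [CompleteSpace E]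
    [SecondCountableTopology E] [MeasurableSpace E] [BorelSpace E]
  {Ω ι : Type*} [MeasurableSpace Ω] {Pr : Measure Ω} [IsProbabilityMeasure Pr] {X : ι → Ω → E}

theorem integral_cosh_norm_sum_le (hind : iIndepFun X Pr) (hX : ∀ i, Measurable (X i)) {b : ℝ}
    (hb : 0 < b) (hXb : ∀ i, ∀ᵐ ω ∂Pr, ‖X i ω‖ ≤ b) (hX0 : ∀ i, ∫ ω, X i ω ∂Pr = 0) (t : ℝ)
    (s : Finset ι) :
    Integrable (fun ω => Real.cosh (t * ‖∑ i ∈ s, X i ω‖)) Pr ∧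
      ∫ ω, Real.cosh (t * ‖∑ i ∈ s, X i ω‖) ∂Pr ≤ Real.cosh (t * b) ^ s.card := by
  classical
  have hsum (s : Finset ι) : ∀ᵐ ω ∂Pr, ‖∑ i ∈ s, X i ω‖ ≤ s.card * b := by
    filter_upwards [(ae_ball_iff s.countable_toSet).2 fun i _ => hXb i] with ω hω
    simpa using norm_sum_le_of_le s (fun i hi => hω i hi)
  have hm (s : Finset ι) : Measurable fun ω => ∑ i ∈ s, X i ω :=
    Finset.measurable_fun_sum _ fun i _ => hX i
  have hint (s : Finset ι) : Integrable (fun ω => Real.cosh (t * ‖∑ i ∈ s, X i ω‖)) Pr := by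
    refine Integrable.of_bound (Real.measurable_cosh.comp
      (measurable_const.mul (hm s).norm)).aestronglyMeasurable (Real.cosh (t * (s.card * b))) ?_
    filter_upwards [hsum s] with ω hω
    rw [Real.norm_eq_abs, abs_of_pos (Real.cosh_pos _), Real.cosh_le_cosh, abs_mul, abs_mul,
      abs_norm]
    gcongr
    exact hω.trans (le_abs_self _)
  refine ⟨hint s, ?_⟩
  induction s using Finset.induction_on with
  | empty => simp
  | insert j s hj ih =>
    set F : E → E := fun x => (Real.sinh (t * ‖x‖) / ‖x‖ * (Real.sinh (t * b) / b)) • x with hF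
    have hFm : Measurable F := by
      refine Measurable.smul (Measurable.mul (Measurable.div ?_ measurable_norm) measurable_const)
        measurable_id
      exact Real.measurable_sinh.comp (measurable_const.mul measurable_norm)
    have hindep : IndepFun (fun ω => F (∑ i ∈ s, X i ω)) (X j) Pr := by
      have := (hind.indepFun_finsetSum_of_notMem hX hj).comp hFm measurable_id
      rw [Function.id_comp] at this
      convert this using 1
      ext ω
      simp
    have hFint : Integrable (fun ω => F (∑ i ∈ s, X i ω)) Pr := by
      refine ((hint s).mul_const |Real.sinh (t * b) / b|).mono'
        (hFm.comp (hm s)).aestronglyMeasurable (ae_of_all _ fun ω => ?_)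
      set x := ∑ i ∈ s, X i ω
      have h1 : |Real.sinh (t * ‖x‖)| ≤ Real.cosh (t * ‖x‖) := by
        rw [abs_le, Real.sinh_eq, Real.cosh_eq]
        constructor <;> linarith [Real.exp_pos (t * ‖x‖), Real.exp_pos (-(t * ‖x‖))]
      rw [hF, norm_smul, Real.norm_eq_abs, abs_mul, abs_div, abs_norm]
      rcases eq_or_ne ‖x‖ 0 with h | h
      · rw [h, div_zero, zero_mul, zero_mul]
        exact mul_nonneg (Real.cosh_pos _).le (abs_nonneg _)
      · calc _ = |Real.sinh (t * ‖x‖)| * |Real.sinh (t * b) / b| := by field_simp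
          _ ≤ _ := by gcongr
    have hXint : Integrable (X j) Pr := Integrable.of_bound (hX j).aestronglyMeasurable b (hXb j)
    have h0 : ∫ ω, inner ℝ (F (∑ i ∈ s, X i ω)) (X j ω) ∂Pr = 0 := by
      have := hindep.integral_bilin hFint hXint (innerSL ℝ)
      rw [hX0 j, map_zero] at this
      exact this
    have hI : Integrable (fun ω => inner ℝ (F (∑ i ∈ s, X i ω)) (X j ω)) Pr := by
      exact hindep.integrable_bilin hFint hXint (innerSL ℝ)
    have hle : ∀ᵐ ω ∂Pr, Real.cosh (t * ‖∑ i ∈ insert j s, X i ω‖) ≤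
        Real.cosh (t * ‖∑ i ∈ s, X i ω‖) * Real.cosh (t * b)
          + inner ℝ (F (∑ i ∈ s, X i ω)) (X j ω) := by
      filter_upwards [hXb j] with ω hω
      rw [Finset.sum_insert hj, add_comm (X j ω)]
      exact cosh_norm_add_le t hb _ _ hω
    calc _ ≤ ∫ ω, (Real.cosh (t * ‖∑ i ∈ s, X i ω‖) * Real.cosh (t * b)
          + inner ℝ (F (∑ i ∈ s, X i ω)) (X j ω)) ∂Pr :=
          integral_mono_ae (hint _) (((hint s).mul_const _).add hI) hle
      _ = (∫ ω, Real.cosh (t * ‖∑ i ∈ s, X i ω‖) ∂Pr) * Real.cosh (t * b) := by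
          rw [integral_add ((hint s).mul_const _) hI, h0, add_zero, integral_mul_const]
      _ ≤ _ := by
          rw [Finset.card_insert_of_notMem hj, pow_succ]
          exact mul_le_mul_of_nonneg_right ih (Real.cosh_pos _).le

/-- **Hoeffding's inequality** in a Hilbert space. -/
theorem measure_norm_sum_ge_le [Fintype ι] [Nonempty ι] (hind : iIndepFun X Pr)
    (hX : ∀ i, Measurable (X i)) {b : ℝ} (hb : 0 < b) (hXb : ∀ i, ∀ᵐ ω ∂Pr, ‖X i ω‖ ≤ b)
    (hX0 : ∀ i, ∫ ω, X i ω ∂Pr = 0) {x : ℝ} (hx : 0 ≤ x) :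
    Pr.real {ω | b * √(2 * Fintype.card ι * x) ≤ ‖∑ i, X i ω‖} ≤ 2 * Real.exp (-x) := by
  set n : ℝ := (Fintype.card ι : ℝ) with hn
  have hn0 : 0 < n := by rw [hn]; exact_mod_cast Fintype.card_pos
  set q : ℝ := √(2 * n * x)
  have hsq : q ^ 2 = 2 * n * x := Real.sq_sqrt (by positivity)
  -- This `t` minimizes the exponent `n (t b)² / 2 - t b q`, whose value is then `x - 2 * x = -x`.
  set t : ℝ := q / (b * n) with ht
  have ht0 : 0 ≤ t := by positivity
  obtain ⟨hint, hle⟩ := integral_cosh_norm_sum_le hind hX hb hXb hX0 t Finset.univ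
  have hmk := mul_meas_ge_le_integral_of_nonneg (ae_of_all _ fun ω => (Real.cosh_pos _).le) hint
    (Real.exp (2 * x) / 2)
  have h1 : Real.cosh (t * b) ^ (Finset.univ : Finset ι).card ≤ Real.exp x := by
    calc _ ≤ Real.exp ((t * b) ^ 2 / 2) ^ (Finset.univ : Finset ι).card := by
          gcongr; exact Real.cosh_le_exp_half_sq _
      _ = Real.exp x := by
          rw [← Real.exp_nat_mul, Finset.card_univ, ← hn, ht]
          congr 1
          field_simp
          linear_combination hsq
  have h2 : {ω | b * q ≤ ‖∑ i, X i ω‖} ⊆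
      {ω | Real.exp (2 * x) / 2 ≤ Real.cosh (t * ‖∑ i, X i ω‖)} := by
    intro ω hω
    simp only [Set.mem_ofPred_eq] at hω ⊢
    have h3 : 2 * x ≤ t * ‖∑ i, X i ω‖ := by
      calc 2 * x = t * (b * q) := by
            rw [ht]; field_simp; linear_combination -hsq
        _ ≤ _ := by gcongr
    rw [Real.cosh_eq]
    have := Real.exp_le_exp.2 h3
    have := Real.exp_pos (-(t * ‖∑ i, X i ω‖))
    linarith
  have h4 := (mul_le_mul_of_nonneg_left (measureReal_mono (μ := Pr) h2)
    (by positivity : 0 ≤ Real.exp (2 * x) / 2)).trans (hmk.trans (hle.trans h1))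
  rw [Real.exp_neg]
  have h5 : Real.exp (2 * x) = Real.exp x * Real.exp x := by rw [← Real.exp_add]; ring_nf
  rw [h5] at h4
  have := Real.exp_pos x
  rw [← div_eq_mul_inv, le_div_iff₀ this]
  refine le_of_mul_le_mul_right ?_ this
  linarith

end Concentration
-- The Bellman equation
section Bellman

variable {S A : Type*} [MeasurableSpace S] [MeasurableSpace A]

namespace MDP

/-- The law of the trajectory of `k` steps that starts in a given state and follows `π`. -/
noncomputable def stateTrajLaw (M : MDP S A) {π : S → A} (hπ : Measurable π) (k : ℕ) :
    Kernel S (Fin k → (S × A) × ℝ) :=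
  (M.trajLaw π k).comap (fun s' => (s', π s')) (by fun_prop)

theorem isMarkovKernel_stateTrajLaw (M : MDP S A) {π : S → A} (hπ : Measurable π) (k : ℕ) :
    IsMarkovKernel (M.stateTrajLaw hπ k) := by
  have := M.isMarkovKernel_trajLaw hπ k
  unfold stateTrajLaw
  infer_instance

theorem trajLaw_succ_apply (M : MDP S A) {π : S → A} (hπ : Measurable π) (k : ℕ) (p : S × A) :
    M.trajLaw π (k + 1) p =
      (((Measure.dirac p).prod (M.R p)).prod ((M.P p).bind (M.stateTrajLaw hπ k))).map
      (fun q => (Fin.cons q.1 q.2 : Fin (k + 1) → (S × A) × ℝ)) := by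
  have := M.isMarkovKernel_trajLaw hπ k
  have h1 : IsMarkovKernel (M.P.map (fun s' => (s', π s'))) :=
    Kernel.IsMarkovKernel.map _ (by fun_prop)
  rw [trajLaw, Kernel.map_apply _ (measurable_cons k), Kernel.prod_apply, Kernel.prod_apply,
    Kernel.id_apply, Kernel.comp_apply, Kernel.map_apply _ (by fun_prop)]
  congr 2
  rw [Measure.bind, Measure.map_map (Kernel.measurable _) (by fun_prop)]
  rfl

theorem ae_trajLaw_reward (M : MDP S A) {π : S → A} (hπ : Measurable π) (k : ℕ) :
    ∀ h, 1 ≤ h → h + k = M.H + 1 → ∀ s ∈ M.level h, ∀ a,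
      ∀ᵐ τ ∂(M.trajLaw π k (s, a)), ∀ t, (τ t).2 ∈ Set.Icc (-1 : ℝ) 1 := by
  induction k with
  | zero => exact fun h _ _ s _ a => ae_of_all _ fun τ t => t.elim0
  | succ k ih =>
    intro h h1 hk s hs a
    have := M.isMarkovKernel_stateTrajLaw hπ k
    have hmeas (k : ℕ) : MeasurableSet
        {τ : Fin k → (S × A) × ℝ | ∀ t, (τ t).2 ∈ Set.Icc (-1 : ℝ) 1} := by
      measurability
    rw [trajLaw_succ_apply M hπ, ae_map_iff (measurable_cons k).aemeasurable (hmeas _)]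
    have hR : ∀ᵐ q ∂((Measure.dirac (s, a)).prod (M.R (s, a))), q.2 ∈ Set.Icc (-1 : ℝ) 1 :=
      Measure.quasiMeasurePreserving_snd.ae (M.reward_bound h ⟨h1, by omega⟩ s hs a)
    have hP : ∀ᵐ τ ∂((M.P (s, a)).bind (M.stateTrajLaw hπ k)),
        ∀ t, (τ t).2 ∈ Set.Icc (-1 : ℝ) 1 := by
      -- For `k = 0` the current level is `H`: nothing is known about the next state, but the
      -- remaining trajectory is empty.
      rcases k with _ | k
      · exact ae_of_all _ fun τ t => t.elim0
      · refine Measure.ae_comp_of_ae_ae (hmeas _) ?_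
        filter_upwards [M.level_step h h1 (by omega) s hs a] with s' hs'
        exact ih (h + 1) (by omega) (by omega) s' hs' _
    filter_upwards [Measure.quasiMeasurePreserving_fst.ae hR,
      Measure.quasiMeasurePreserving_snd.ae hP] with q hq1 hq2 t
    refine Fin.cases ?_ (fun t => ?_) t
    · simpa using hq1
    · simpa using hq2 t

theorem integrable_trajLaw (M : MDP S A) {π : S → A} (hπ : Measurable π) {k h : ℕ} (h1 : 1 ≤ h)
    (hk : h + k = M.H + 1) {s : S} (hs : s ∈ M.level h) (a : A) :
    Integrable (fun τ => ∑ t, (τ t).2) (M.trajLaw π k (s, a)) := by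
  have := M.isMarkovKernel_trajLaw hπ k
  refine integrable_finsetSum _ fun t _ => Integrable.of_bound
    (Measurable.aestronglyMeasurable (by fun_prop)) 1 ?_
  filter_upwards [M.ae_trajLaw_reward hπ k h h1 hk s hs a] with τ hτ
  exact abs_le.2 (hτ t)

/-- The Bellman equation. -/
theorem Q_eq_integral_add (M : MDP S A) {π : S → A} (hπ : Measurable π) {h : ℕ}
    (hh : h ∈ Set.Icc 1 M.H) {s : S} (hs : s ∈ M.level h) (a : A) :
    M.Q π h s a = ∫ r, r ∂(M.R (s, a)) + ∫ s', M.Q π (h + 1) s' (π s') ∂(M.P (s, a)) := by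
  obtain ⟨k, hk⟩ : ∃ k, h + (k + 1) = M.H + 1 := ⟨M.H - h, by have := hh.2; omega⟩
  have e1 : M.H + 1 - h = k + 1 := by omega
  have e2 : M.H + 1 - (h + 1) = k := by omega
  unfold Q
  rw [e1, e2]
  have := M.isMarkovKernel_stateTrajLaw hπ k
  have hint := M.integrable_trajLaw hπ hh.1 hk hs a
  rw [trajLaw_succ_apply M hπ] at hint ⊢
  have hm {μ : Measure (Fin (k + 1) → (S × A) × ℝ)} :
      AEStronglyMeasurable (fun τ : Fin (k + 1) → (S × A) × ℝ => ∑ t, (τ t).2) μ :=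
    Measurable.aestronglyMeasurable (by fun_prop)
  rw [integrable_map_measure hm (measurable_cons k).aemeasurable] at hint
  rw [integral_map (measurable_cons k).aemeasurable hm]
  simp only [Function.comp_def, Fin.sum_univ_succ, Fin.cons_zero, Fin.cons_succ] at hint ⊢
  have hR : Integrable (fun q : (S × A) × ℝ => q.2)
      ((Measure.dirac (s, a)).prod (M.R (s, a))) := by
    refine Integrable.of_bound measurable_snd.aestronglyMeasurable 1 ?_
    filter_upwards [Measure.quasiMeasurePreserving_snd.ae (M.reward_bound h hh s hs a)] with q hq
    exact abs_le.2 hq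
  have hP : Integrable (fun q : ((S × A) × ℝ) × (Fin k → (S × A) × ℝ) => ∑ t, (q.2 t).2)
      (((Measure.dirac (s, a)).prod (M.R (s, a))).prod
        ((M.P (s, a)).bind (M.stateTrajLaw hπ k))) := by
    refine (hint.sub (hR.comp_fst _)).congr (ae_of_all _ fun q => ?_)
    simp
  rw [integral_add (hR.comp_fst _) hP,
    integral_fun_fst (f := fun q : (S × A) × ℝ => q.2),
    integral_fun_snd (f := fun τ : Fin k → (S × A) × ℝ => ∑ t, (τ t).2),
    integral_fun_snd (f := fun r : ℝ => r)]
  simp only [probReal_univ, one_smul]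
  congr 1
  have hP' := Integrable.of_comp_snd (f := fun τ : Fin k → (S × A) × ℝ => ∑ t, (τ t).2) hP
    (IsProbabilityMeasure.ne_zero _)
  rw [Measure.comp_eq_comp_const_apply] at hP' ⊢
  rw [Kernel.integral_comp hP', Kernel.const_apply]
  rfl

end MDP
end Bellman
-- Ridge regression and the error recursion
section LeastSquares

section Energy

variable {E : Type*} [NormedAddCommGroup E] [InnerProductSpace ℝ E] {ι : Type*} [Fintype ι]

/-- The squared norm of `z` for the regularized empirical covariance of the features `f`. -/
noncomputable def energy (f : ι → E) (lam : ℝ) (z : E) : ℝ :=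
  ∑ i, inner ℝ (f i) z ^ 2 + lam * ‖z‖ ^ 2

theorem energy_nonneg (f : ι → E) {lam : ℝ} (hlam : 0 ≤ lam) (z : E) : 0 ≤ energy f lam z := by
  unfold energy; positivity

/-- The error `θ - θ'` of a ridge regression estimate `θ'` with misspecified targets. -/
theorem sqrt_energy_sub_le {f : ι → E} {lam : ℝ} (hlam : 0 < lam) {θ θ' : E} {n x : ι → ℝ}
    (h : ∑ i, inner ℝ (f i) θ' • f i + lam • θ'
      = ∑ i, (n i + inner ℝ (f i) θ - x i) • f i) :
    √(energy f lam (θ - θ')) ≤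
      √lam * ‖θ‖ + ‖∑ i, n i • f i‖ / √lam + √(∑ i, x i ^ 2) := by
  set z := θ - θ' with hz
  set e := √(energy f lam z)
  have hsq : e ^ 2 = ∑ i, inner ℝ (f i) z ^ 2 + lam * ‖z‖ ^ 2 :=
    Real.sq_sqrt (energy_nonneg f hlam.le z)
  have hl : √lam ^ 2 = lam := Real.sq_sqrt hlam.le
  have hl0 : 0 < √lam := Real.sqrt_pos.2 hlam
  have he0 : 0 ≤ e := Real.sqrt_nonneg _
  -- The normal equation paired with `z`. By Cauchy-Schwarz each of the three terms is at most a
  -- constant times `e`, and one factor `e` cancels.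
  have hid : e ^ 2 = lam * inner ℝ θ z - inner ℝ (∑ i, n i • f i) z
      + ∑ i, x i * inner ℝ (f i) z := by
    have h1 := congrArg (fun y => inner ℝ y z) h
    simp only [inner_add_left, sum_inner, real_inner_smul_left] at h1 ⊢
    have h2 : ∀ i, inner ℝ (f i) z ^ 2
        = inner ℝ (f i) θ * inner ℝ (f i) z - inner ℝ (f i) θ' * inner ℝ (f i) z := fun i => by
      conv_lhs => rw [sq]
      rw [← sub_mul, ← inner_sub_right]
    have h3 : ‖z‖ ^ 2 = inner ℝ θ z - inner ℝ θ' z := by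
      rw [← inner_sub_left, ← hz, real_inner_self_eq_norm_sq]
    rw [hsq, h3, Finset.sum_congr rfl fun i _ => h2 i, Finset.sum_sub_distrib]
    simp only [add_mul, sub_mul, Finset.sum_add_distrib, Finset.sum_sub_distrib] at h1
    linarith
  have hz1 : √lam * ‖z‖ ≤ e := by
    refine Real.le_sqrt_of_sq_le ?_
    rw [mul_pow, hl, energy]
    have : 0 ≤ ∑ i, inner ℝ (f i) z ^ 2 := Finset.sum_nonneg fun i _ => sq_nonneg _
    linarith
  have hz2 : √(∑ i, inner ℝ (f i) z ^ 2) ≤ e := by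
    refine Real.sqrt_le_sqrt ?_
    rw [energy]
    have : 0 ≤ lam * ‖z‖ ^ 2 := by positivity
    linarith
  have b1 : lam * inner ℝ θ z ≤ √lam * ‖θ‖ * e := by
    calc lam * inner ℝ θ z ≤ lam * (‖θ‖ * ‖z‖) := by gcongr; exact real_inner_le_norm _ _
      _ = √lam * ‖θ‖ * (√lam * ‖z‖) := by linear_combination (-(‖θ‖ * ‖z‖)) * hl
      _ ≤ _ := by gcongr
  have b2 : -inner ℝ (∑ i, n i • f i) z ≤ ‖∑ i, n i • f i‖ / √lam * e := by
    calc -inner ℝ (∑ i, n i • f i) z ≤ ‖∑ i, n i • f i‖ * ‖z‖ :=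
          (neg_le_abs _).trans (abs_real_inner_le_norm _ _)
      _ = ‖∑ i, n i • f i‖ / √lam * (√lam * ‖z‖) := by field_simp
      _ ≤ _ := by gcongr
  have b3 : ∑ i, x i * inner ℝ (f i) z ≤ √(∑ i, x i ^ 2) * e :=
    (Real.sum_mul_le_sqrt_mul_sqrt _ _ _).trans (by gcongr)
  rcases he0.eq_or_lt with h0 | h0
  · rw [← h0]; positivity
  · refine le_of_mul_le_mul_right ?_ h0
    linarith [sq e]

end Energy

/-- Unrolling a recursive bound on errors that start from level `H`. -/
theorem le_of_backward_recursion {H : ℕ} {a : ℝ} (ha : 0 ≤ a) {e b : ℕ → ℝ}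
    (hb : ∀ h ∈ Set.Icc 1 H, 1 ≤ b h) (hH : e H ≤ a)
    (hstep : ∀ h, 1 ≤ h → h < H → e h ≤ a + √(b (h + 1)) * e (h + 1)) (k : ℕ) :
    ∀ h, 1 ≤ h → h + k = H → e h ≤ (k + 1) * a * √(∏ j ∈ Finset.Ioc h H, b j) := by
  induction k with
  | zero => rintro h - rfl; simpa using hH
  | succ k ih =>
    intro h h1 hk
    have hprod : ∏ j ∈ Finset.Ioc h H, b j = b (h + 1) * ∏ j ∈ Finset.Ioc (h + 1) H, b j := by
      rw [← Finset.insert_Ioc_add_one_left_eq_Ioc (by omega), Finset.prod_insert (by simp)]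
    -- Since every `b j ≥ 1`, each of the `k + 1` contributions `a` may be charged the full product.
    have hone : 1 ≤ √(∏ j ∈ Finset.Ioc h H, b j) := by
      rw [Real.one_le_sqrt]
      rw [← Finset.prod_const_one (ι := ℕ) (s := Finset.Ioc h H)]
      refine Finset.prod_le_prod (fun _ _ => zero_le_one) fun j hj => hb j ?_
      rw [Finset.mem_Ioc] at hj
      exact ⟨by omega, hj.2⟩
    calc e h ≤ a + √(b (h + 1)) * e (h + 1) := hstep h h1 (by omega)
      _ ≤ a + √(b (h + 1)) * ((k + 1) * a * √(∏ j ∈ Finset.Ioc (h + 1) H, b j)) := by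
          gcongr; exact ih (h + 1) (by omega) (by omega)
      _ = a * 1 + (k + 1) * a * √(∏ j ∈ Finset.Ioc h H, b j) := by
          rw [hprod, Real.sqrt_mul (zero_le_one.trans (hb (h + 1) ⟨by omega, by omega⟩))]; ring
      _ ≤ a * √(∏ j ∈ Finset.Ioc h H, b j) + (k + 1) * a * √(∏ j ∈ Finset.Ioc h H, b j) := by
          gcongr
      _ = _ := by push_cast; ring

variable {S A : Type*} {d N : ℕ}

theorem vecMulVec_mulVec_ofLp (x y : EuclideanSpace ℝ (Fin d)) :
    Matrix.vecMulVec x x *ᵥ y.ofLp = (inner ℝ x y • x).ofLp := by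
  rw [Matrix.vecMulVec_mulVec, EuclideanSpace.inner_eq_star_dotProduct, star_trivial,
    dotProduct_comm]
  ext i
  simp [mul_comm]

theorem empCov_mulVec [MeasurableSpace S] [MeasurableSpace A]
    (φ : S → A → EuclideanSpace ℝ (Fin d)) (lam : ℝ)
    (D : Fin N → Sample S A) (y : EuclideanSpace ℝ (Fin d)) :
    empCov φ lam D *ᵥ y.ofLp =
      (∑ i, inner ℝ (φ (D i).1.1 (D i).1.2) y • φ (D i).1.1 (D i).1.2 + lam • y).ofLp := by
  rw [empCov, Matrix.add_mulVec, Matrix.sum_mulVec]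
  simp only [vecMulVec_mulVec_ofLp, Matrix.smul_mulVec, Matrix.one_mulVec, WithLp.ofLp_add,
    WithLp.ofLp_sum, WithLp.ofLp_smul]

theorem isUnit_empCov [MeasurableSpace S] [MeasurableSpace A]
    (φ : S → A → EuclideanSpace ℝ (Fin d)) {lam : ℝ} (hlam : 0 < lam)
    (D : Fin N → Sample S A) : IsUnit (empCov φ lam D) := by
  refine Matrix.PosDef.isUnit (Matrix.PosDef.posSemidef_add
    (Matrix.posSemidef_sum _ fun i _ => ?_) (Matrix.PosDef.one.smul hlam))
  simpa using Matrix.posSemidef_vecMulVec_self_star (φ (D i).1.1 (D i).1.2).ofLp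

/-- The normal equation of Least-Squares Policy Evaluation. -/
theorem thetaHat_normal_eq [MeasurableSpace S] [MeasurableSpace A]
    (φ : S → A → EuclideanSpace ℝ (Fin d)) (π : S → A) {lam : ℝ} (hlam : 0 < lam) {H h : ℕ}
    (hh : h ≤ H) (D : ℕ → Fin N → Sample S A) :
    ∑ i, inner ℝ (φ (D h i).1.1 (D h i).1.2) (thetaHat φ π lam H D h) • φ (D h i).1.1 (D h i).1.2
        + lam • thetaHat φ π lam H D h =
      ∑ i, ((D h i).2.1
          + inner ℝ (φ (D h i).2.2 (π (D h i).2.2)) (thetaHat φ π lam H D (h + 1))) •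
        φ (D h i).1.1 (D h i).1.2 := by
  refine WithLp.ofLp_injective 2 ?_
  rw [← empCov_mulVec]
  conv_lhs => rw [thetaHat, if_pos hh]
  rw [Matrix.mulVec_mulVec, Matrix.mul_nonsing_inv _
    ((Matrix.isUnit_iff_isUnit_det _).1 (isUnit_empCov φ hlam _)), Matrix.one_mulVec]

theorem thetaHat_eq_zero [MeasurableSpace S] [MeasurableSpace A]
    (φ : S → A → EuclideanSpace ℝ (Fin d)) (π : S → A) (lam : ℝ) {H h : ℕ}
    (hh : H < h) (D : ℕ → Fin N → Sample S A) : thetaHat φ π lam H D h = 0 := by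
  rw [thetaHat, if_neg (by omega)]

end LeastSquares

/-! ### Empirical averages of quadratic forms -/

section Empirical

theorem norm_coord_mul_le {d : ℕ} {x : EuclideanSpace ℝ (Fin d)} (hx : ‖x‖ ≤ 1) (i j : Fin d) :
    ‖x i * x j‖ ≤ 1 := by
  rw [norm_mul]
  exact mul_le_one₀ ((PiLp.norm_apply_le _ _).trans hx) (norm_nonneg _)
    ((PiLp.norm_apply_le _ _).trans hx)

variable {Y Ω : Type*} [MeasurableSpace Y] [MeasurableSpace Ω] {Pr : Measure Ω} {ν : Measure Y}
  {N d : ℕ} {D : Fin N → Ω → Y}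

theorem measure_iid_norm_sum_ge_le [IsProbabilityMeasure Pr] {E : Type*}
    [NormedAddCommGroup E] [InnerProductSpace ℝ E] [CompleteSpace E]
    [SecondCountableTopology E] [MeasurableSpace E] [BorelSpace E]
    (hN : 1 ≤ N) (hD : ∀ i, Measurable (D i) ∧ Pr.map (D i) = ν) (hind : iIndepFun D Pr)
    {g : Y → E} (hg : Measurable g) {b : ℝ} (hb : 0 < b) (hgb : ∀ᵐ y ∂ν, ‖g y‖ ≤ b)
    (hg0 : ∫ y, g y ∂ν = 0) {x : ℝ} (hx : 0 ≤ x) :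
    Pr.real {ω | b * √(2 * N * x) ≤ ‖∑ i, g (D i ω)‖} ≤ 2 * Real.exp (-x) := by
  have : Nonempty (Fin N) := ⟨⟨0, hN⟩⟩
  have := measure_norm_sum_ge_le (X := fun i ω => g (D i ω)) (hind.comp _ fun _ => hg)
    (fun i => hg.comp (hD i).1) hb
    (fun i => ae_of_ae_map (hD i).1.aemeasurable ((hD i).2.symm ▸ hgb))
    (fun i => by
      rw [← hg0, ← (hD i).2, integral_map (hD i).1.aemeasurable hg.aestronglyMeasurable]) hx
  simpa using this

/-- Uniformity in `v` is free: `⟨f, v⟩²` is the inner product of the tensor squares of `f` and `v`,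
so a norm bound on one centered sum of tensor squares serves all `v`. The centered summands have
norm at most `2`. -/
theorem measure_quadratic_dev_le [IsProbabilityMeasure Pr] [IsProbabilityMeasure ν]
    (hN : 1 ≤ N) (hD : ∀ i, Measurable (D i) ∧ Pr.map (D i) = ν) (hind : iIndepFun D Pr)
    {f : Y → EuclideanSpace ℝ (Fin d)} (hf : Measurable f) (hf1 : ∀ y, ‖f y‖ ≤ 1)
    {x : ℝ} (hx : 0 ≤ x) :
    Pr.real {ω | ∃ v, 2 * √(2 * N * x) * ‖v‖ ^ 2 <
      |∑ i, inner ℝ (f (D i ω)) v ^ 2 - N * ∫ y, inner ℝ (f y) v ^ 2 ∂ν|} ≤ 2 * Real.exp (-x) := by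
  let F : EuclideanSpace ℝ (Fin d) → EuclideanSpace ℝ (Fin d × Fin d) :=
    fun v => WithLp.toLp 2 fun p => v p.1 * v p.2
  have hFm : Measurable F := by
    have : Continuous F := by fun_prop
    exact this.measurable
  have hFi (u v : EuclideanSpace ℝ (Fin d)) : inner ℝ (F u) (F v) = inner ℝ u v ^ 2 := by
    simp only [F, PiLp.inner_apply, RCLike.inner_apply, conj_trivial, sq, Finset.sum_mul_sum,
      Fintype.sum_prod_type]
    refine Finset.sum_congr rfl fun i _ => Finset.sum_congr rfl fun j _ => by ring
  have hFn (v : EuclideanSpace ℝ (Fin d)) : ‖F v‖ = ‖v‖ ^ 2 := by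
    rw [← sq_eq_sq₀ (norm_nonneg _) (sq_nonneg _), ← real_inner_self_eq_norm_sq, hFi,
      real_inner_self_eq_norm_sq]
  have hb : ∀ y, ‖F (f y)‖ ≤ 1 := fun y => by
    rw [hFn]; exact pow_le_one₀ (norm_nonneg _) (hf1 y)
  have hint : Integrable (fun y => F (f y)) ν :=
    Integrable.of_bound (hFm.comp hf).aestronglyMeasurable 1 (ae_of_all _ hb)
  set m := ∫ y, F (f y) ∂ν with hm
  have hm1 : ‖m‖ ≤ 1 := by
    simpa using norm_integral_le_of_norm_le_const (μ := ν) (ae_of_all _ hb)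
  have key := measure_iid_norm_sum_ge_le hN hD hind (g := fun y => F (f y) - m)
    ((hFm.comp hf).sub_const _) two_pos
    (ae_of_all _ fun y => (norm_sub_le _ _).trans (by linarith [hb y]))
    (by rw [integral_sub hint (integrable_const _)]; simp [hm]) hx
  refine (measureReal_mono ?_).trans key
  rintro ω ⟨v, hv⟩
  by_contra hcon
  simp only [Set.mem_ofPred_eq, not_le] at hcon
  have h1 : ∑ i, inner ℝ (f (D i ω)) v ^ 2 - N * ∫ y, inner ℝ (f y) v ^ 2 ∂ν
      = inner ℝ (∑ i, (F (f (D i ω)) - m)) (F v) := by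
    have : ∫ y, inner ℝ (f y) v ^ 2 ∂ν = inner ℝ m (F v) := by
      rw [hm, real_inner_comm, ← integral_inner hint]
      simp_rw [real_inner_comm, hFi]
    rw [sum_inner]
    simp [inner_sub_left, hFi, this]
  rw [h1] at hv
  have h2 := abs_real_inner_le_norm (∑ i, (F (f (D i ω)) - m)) (F v)
  rw [hFn] at h2
  exact absurd (hv.trans_le h2) (not_lt.2 (by gcongr))

theorem dotProduct_covariance_mulVec [IsFiniteMeasure ν] {f : Y → EuclideanSpace ℝ (Fin d)}
    (hf : Measurable f) (hf1 : ∀ y, ‖f y‖ ≤ 1) (v : EuclideanSpace ℝ (Fin d)) :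
    v.ofLp ⬝ᵥ ((Matrix.of fun i j => ∫ y, f y i * f y j ∂ν) *ᵥ v.ofLp) =
      ∫ y, inner ℝ (f y) v ^ 2 ∂ν := by
  have hc (i : Fin d) : Measurable fun y => f y i := by fun_prop
  have hint (i j : Fin d) : Integrable (fun y => v i * (f y i * f y j * v j)) ν := by
    refine ((Integrable.of_bound ((hc i).mul (hc j)).aestronglyMeasurable 1
      (ae_of_all _ fun y => ?_)).mul_const _).const_mul _
    exact norm_coord_mul_le (hf1 y) i j
  have h1 (y : Y) : inner ℝ (f y) v ^ 2 = ∑ i, ∑ j, v i * (f y i * f y j * v j) := by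
    simp only [PiLp.inner_apply, RCLike.inner_apply, conj_trivial, sq, Finset.sum_mul_sum]
    refine Finset.sum_congr rfl fun i _ => Finset.sum_congr rfl fun j _ => by ring
  simp_rw [h1]
  rw [integral_finsetSum _ fun i _ => integrable_finsetSum _ fun j _ => hint i j]
  simp_rw [integral_finsetSum _ fun j _ => hint _ j, integral_const_mul, integral_mul_const,
    dotProduct, Matrix.mulVec, dotProduct, Matrix.of_apply, Finset.mul_sum]

end Empirical
-- Propagation of errors across levels
section ErrorPropagation

/-- How the errors `z h` of the levels propagate to level `1`, given that the empirical quadratic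
forms of the features `f` and of the lookahead features `f'` are close to the population quadratic
forms `q` and `q'`. -/
theorem lookahead_error_le {E : Type*} [NormedAddCommGroup E] [InnerProductSpace ℝ E] {N H : ℕ}
    (hH : 1 ≤ H) {f f' : ℕ → Fin N → E} {z : ℕ → E} {q q' : ℕ → E → ℝ} {Cs : ℕ → ℝ}
    {lam r a ρ : ℝ} (hlam : 0 < lam) (hr : 0 ≤ r) (ha : 0 ≤ a) (hρ : 1 + 2 * r / lam ≤ ρ)
    (hz : ∀ h ∈ Set.Icc 1 H, √(energy (f h) lam (z h)) ≤
      a + √(∑ i, inner ℝ (f' h i) (z (h + 1)) ^ 2))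
    (hzH : z (H + 1) = 0)
    (hq : ∀ h ∈ Set.Icc 1 H, ∀ v, |∑ i, inner ℝ (f h i) v ^ 2 - N * q h v| ≤ r * ‖v‖ ^ 2)
    (hq' : ∀ h, 1 ≤ h → h < H → ∀ v,
      |∑ i, inner ℝ (f' h i) v ^ 2 - N * q' (h + 1) v| ≤ r * ‖v‖ ^ 2)
    (hC : ∀ h ∈ Set.Icc 1 H, 1 ≤ Cs h ∧ ∀ v, q' h v ≤ Cs h * q h v) :
    N * q' 1 (z 1) ≤ (∏ h ∈ Finset.Icc 1 H, Cs h) * ρ ^ H * (H * a) ^ 2 := by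
  have hρ1 : 1 ≤ ρ := le_trans (by linarith [show 0 ≤ 2 * r / lam by positivity]) hρ
  -- The term `r ‖v‖²` on the left pays for replacing the empirical lookahead form by `q'`; another
  -- one arises in replacing `q` by the empirical form. Together they are `2r/λ` times the ridge
  -- part of the energy.
  have key : ∀ h ∈ Set.Icc 1 H, ∀ v,
      N * q' h v + r * ‖v‖ ^ 2 ≤ ρ * Cs h * energy (f h) lam v := by
    intro h hh v
    obtain ⟨h1, h2⟩ := hC h hh
    have h3 := (abs_le.1 (hq h hh v)).1
    have h4 : r * ‖v‖ ^ 2 ≤ Cs h * (r * ‖v‖ ^ 2) := le_mul_of_one_le_left (by positivity) h1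
    have h5 : ∑ i, inner ℝ (f h i) v ^ 2 + 2 * (r * ‖v‖ ^ 2) ≤ ρ * energy (f h) lam v := by
      have h6 : 0 ≤ ∑ i, inner ℝ (f h i) v ^ 2 := Finset.sum_nonneg fun i _ => sq_nonneg _
      calc _ ≤ (1 + 2 * r / lam) * energy (f h) lam v := by
            have h7 : 0 ≤ 2 * r / lam * ∑ i, inner ℝ (f h i) v ^ 2 := by positivity
            have h8 : 2 * r / lam * (lam * ‖v‖ ^ 2) = 2 * (r * ‖v‖ ^ 2) := by field_simp
            have h9 : 0 ≤ lam * ‖v‖ ^ 2 := by positivity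
            rw [energy, add_mul, mul_add (2 * r / lam), h8]
            linarith
        _ ≤ _ := mul_le_mul_of_nonneg_right hρ (energy_nonneg _ hlam.le v)
    calc N * q' h v + r * ‖v‖ ^ 2
        ≤ N * (Cs h * q h v) + Cs h * (r * ‖v‖ ^ 2) := by gcongr; exact h2 v
      _ = Cs h * (N * q h v + r * ‖v‖ ^ 2) := by ring
      _ ≤ Cs h * (∑ i, inner ℝ (f h i) v ^ 2 + 2 * (r * ‖v‖ ^ 2)) := by
          refine mul_le_mul_of_nonneg_left ?_ (zero_le_one.trans h1)
          linarith
      _ ≤ Cs h * (ρ * energy (f h) lam v) := by gcongr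
      _ = _ := by ring
  have hb : ∀ h ∈ Set.Icc 1 H, 1 ≤ ρ * Cs h := fun h hh =>
    one_le_mul_of_one_le_of_one_le hρ1 (hC h hh).1
  obtain ⟨k, rfl⟩ : ∃ k, H = 1 + k := ⟨H - 1, by omega⟩
  have hrec := le_of_backward_recursion (e := fun h => √(energy (f h) lam (z h)))
    (b := fun h => ρ * Cs h) ha hb (by simpa [hzH] using hz (1 + k) ⟨hH, le_rfl⟩)
    (fun h h1 h2 => by
      refine (hz h ⟨h1, h2.le⟩).trans ?_
      have hm : h + 1 ∈ Set.Icc 1 (1 + k) := ⟨by omega, h2⟩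
      rw [← Real.sqrt_mul (zero_le_one.trans (hb _ hm))]
      gcongr
      linarith [key _ hm (z (h + 1)), (abs_le.1 (hq' h h1 h2 (z (h + 1)))).2]) k 1 le_rfl rfl
  have hm : 1 ∈ Set.Icc 1 (1 + k) := ⟨le_rfl, hH⟩
  have hprod0 : 0 ≤ ∏ j ∈ Finset.Ioc 1 (1 + k), ρ * Cs j := by
    refine Finset.prod_nonneg fun j hj => zero_le_one.trans (hb j ?_)
    rw [Finset.mem_Ioc] at hj
    exact ⟨by omega, hj.2⟩
  have hsq : energy (f 1) lam (z 1) ≤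
      ((k + 1) * a) ^ 2 * ∏ j ∈ Finset.Ioc 1 (1 + k), ρ * Cs j := by
    have := pow_le_pow_left₀ (Real.sqrt_nonneg _) hrec 2
    rwa [Real.sq_sqrt (energy_nonneg _ hlam.le _), mul_pow _ √_, Real.sq_sqrt hprod0] at this
  -- The recursion supplies the factors of levels `2, …, H`; that of level `1` comes from the final
  -- comparison at the initial state.
  have hsplit : (∏ h ∈ Finset.Icc 1 (1 + k), Cs h) * ρ ^ (1 + k)
      = ρ * Cs 1 * ∏ j ∈ Finset.Ioc 1 (1 + k), ρ * Cs j := by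
    rw [← Finset.prod_insert (f := fun j => ρ * Cs j) (by simp),
      Finset.Ioc_insert_left hH, Finset.prod_mul_distrib, Finset.prod_const,
      Nat.card_Icc, mul_comm]
    simp
  calc (N : ℝ) * q' 1 (z 1) ≤ ρ * Cs 1 * energy (f 1) lam (z 1) := by
        have : 0 ≤ r * ‖z 1‖ ^ 2 := by positivity
        linarith [key 1 hm (z 1)]
    _ ≤ ρ * Cs 1 * (((k + 1) * a) ^ 2 * ∏ j ∈ Finset.Ioc 1 (1 + k), ρ * Cs j) :=
        mul_le_mul_of_nonneg_left hsq (zero_le_one.trans (hb 1 hm))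
    _ = _ := by rw [hsplit]; push_cast; ring

end ErrorPropagation

/-! ### Population covariances and the regression noise -/

section Population

variable {S A : Type*} [MeasurableSpace S] [MeasurableSpace A] {d : ℕ} (M : MDP S A)
  {φ : S → A → EuclideanSpace ℝ (Fin d)} {π : S → A}

instance (μ : Measure (S × A)) [IsProbabilityMeasure μ] :
    IsProbabilityMeasure (sampleLaw M μ) := by
  unfold sampleLaw; infer_instance

theorem integral_sampleLaw_fst (μ : Measure (S × A)) [IsProbabilityMeasure μ] {g : S × A → ℝ}
    (hg : Measurable g) : ∫ y, g y.1 ∂(sampleLaw M μ) = ∫ p, g p ∂μ := by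
  rw [← integral_map (f := g) (φ := Prod.fst) measurable_fst.aemeasurable hg.aestronglyMeasurable]
  congr 1
  exact Measure.fst_compProd _ _

theorem integral_sampleLaw_next (μ : Measure (S × A)) [IsProbabilityMeasure μ] {g : S → ℝ}
    (hg : Measurable g) {b : ℝ} (hgb : ∀ s, ‖g s‖ ≤ b) :
    ∫ y, g y.2.2 ∂(sampleLaw M μ) = ∫ p, ∫ s', g s' ∂(M.P p) ∂μ := by
  have hint : Integrable (fun y : Sample S A => g y.2.2) (μ ⊗ₘ (M.R ×ₖ M.P)) :=
    Integrable.of_bound (hg.comp (measurable_snd.comp measurable_snd)).aestronglyMeasurable b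
      (ae_of_all _ fun y => hgb _)
  rw [sampleLaw, Measure.integral_compProd hint]
  simp_rw [Kernel.prod_apply]
  refine integral_congr_ae (ae_of_all _ fun p => ?_)
  simpa using integral_fun_snd (μ := M.R p) (ν := M.P p) g

theorem dotProduct_featCov_mulVec (hφ : Measurable (fun p : S × A => φ p.1 p.2))
    (hφ1 : ∀ s a, ‖φ s a‖ ≤ 1) (μ : Measure (S × A)) [IsProbabilityMeasure μ]
    (v : EuclideanSpace ℝ (Fin d)) :
    v.ofLp ⬝ᵥ (featCov φ μ *ᵥ v.ofLp) =
      ∫ y, inner ℝ (φ y.1.1 y.1.2) v ^ 2 ∂(sampleLaw M μ) := by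
  rw [integral_sampleLaw_fst M μ (g := fun p => inner ℝ (φ p.1 p.2) v ^ 2) (by fun_prop)]
  exact dotProduct_covariance_mulVec hφ (fun p => hφ1 _ _) v

theorem dotProduct_lookaheadCov_succ_mulVec (hφ : Measurable (fun p : S × A => φ p.1 p.2))
    (hπ : Measurable π) (hφ1 : ∀ s a, ‖φ s a‖ ≤ 1) (μ : ℕ → Measure (S × A)) {h : ℕ} (hh : 1 ≤ h)
    [IsProbabilityMeasure (μ h)] (v : EuclideanSpace ℝ (Fin d)) :
    v.ofLp ⬝ᵥ (lookaheadCov M φ π μ (h + 1) *ᵥ v.ofLp) =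
      ∫ y, inner ℝ (φ y.2.2 (π y.2.2)) v ^ 2 ∂(sampleLaw M (μ h)) := by
  have hm : Measurable fun s => φ s (π s) :=
    hφ.comp (measurable_id.prodMk hπ)
  have h1 : lookaheadCov M φ π μ (h + 1) = Matrix.of fun i j =>
      ∫ y, φ y.2.2 (π y.2.2) i * φ y.2.2 (π y.2.2) j ∂(sampleLaw M (μ h)) := by
    rw [lookaheadCov, if_neg (by omega), Nat.add_sub_cancel]
    ext i j
    exact (integral_sampleLaw_next M (μ h) (g := fun s => φ s (π s) i * φ s (π s) j) (by fun_prop)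
      (fun s => norm_coord_mul_le (hφ1 _ _) i j)).symm
  rw [h1]
  exact dotProduct_covariance_mulVec (f := fun y : Sample S A => φ y.2.2 (π y.2.2))
    (by fun_prop) (fun y => hφ1 _ _) v

theorem dotProduct_lookaheadCov_one_mulVec (μ : ℕ → Measure (S × A))
    (v : EuclideanSpace ℝ (Fin d)) :
    v.ofLp ⬝ᵥ (lookaheadCov M φ π μ 1 *ᵥ v.ofLp) = inner ℝ (φ M.s₁ (π M.s₁)) v ^ 2 := by
  rw [lookaheadCov, if_pos rfl, vecMulVec_mulVec_ofLp, WithLp.ofLp_smul, dotProduct_smul,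
    smul_eq_mul, sq, EuclideanSpace.inner_eq_star_dotProduct, star_trivial]

/-- The noise in the regression targets of a sample: the deviation of the reward plus the value of
the next state from its conditional expectation. -/
noncomputable def noise (φ : S → A → EuclideanSpace ℝ (Fin d)) (π : S → A)
    (θ θ' : EuclideanSpace ℝ (Fin d)) (y : Sample S A) : ℝ :=
  y.2.1 + inner ℝ (φ y.2.2 (π y.2.2)) θ' - inner ℝ (φ y.1.1 y.1.2) θ

theorem measurable_noise (hφ : Measurable (fun p : S × A => φ p.1 p.2)) (hπ : Measurable π)
    (θ θ' : EuclideanSpace ℝ (Fin d)) : Measurable (noise φ π θ θ') := by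
  have hm : Measurable fun s => φ s (π s) := hφ.comp (measurable_id.prodMk hπ)
  have h1 : Measurable fun y : Sample S A => φ y.2.2 (π y.2.2) := by fun_prop
  have h2 : Measurable fun y : Sample S A => φ y.1.1 y.1.2 := hφ.comp measurable_fst
  unfold noise
  fun_prop

theorem ae_norm_noise_smul_le (hφ1 : ∀ s a, ‖φ s a‖ ≤ 1) {h : ℕ}
    (hh : h ∈ Set.Icc 1 M.H) {μ : Measure (S × A)} [IsProbabilityMeasure μ]
    (hμ : ∀ᵐ p ∂μ, p.1 ∈ M.level h) {θ θ' : EuclideanSpace ℝ (Fin d)} {B : ℝ} (hB : 1 ≤ B)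
    (hθ : ‖θ‖ ≤ B) (hθ' : ‖θ'‖ ≤ B) :
    ∀ᵐ y ∂(sampleLaw M μ), ‖noise φ π θ θ' y • φ y.1.1 y.1.2‖ ≤ 3 * B := by
  have hrew : ∀ᵐ y ∂(sampleLaw M μ), y.2.1 ∈ Set.Icc (-1 : ℝ) 1 := by
    refine Measure.ae_compProd_of_ae_ae ?_ ?_
    · exact measurableSet_Icc.preimage (by fun_prop)
    · filter_upwards [hμ] with p hp
      rw [Kernel.prod_apply]
      exact Measure.quasiMeasurePreserving_fst.ae (M.reward_bound h hh p.1 hp p.2)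
  filter_upwards [hrew] with y hy
  have h1 (x : EuclideanSpace ℝ (Fin d)) (s : S) (a : A) (hx : ‖x‖ ≤ B) :
      |inner ℝ (φ s a) x| ≤ B :=
    (abs_real_inner_le_norm _ _).trans
      ((mul_le_of_le_one_left (norm_nonneg _) (hφ1 s a)).trans hx)
  have h2 := abs_le.1 (h1 θ y.1.1 y.1.2 hθ)
  have h3 := abs_le.1 (h1 θ' y.2.2 (π y.2.2) hθ')
  rw [norm_smul]
  refine (mul_le_of_le_one_right (norm_nonneg _) (hφ1 _ _)).trans (abs_le.2 ?_)
  unfold noise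
  constructor <;> linarith [hy.1, hy.2]

/-- Given `(s, a)` the feature is constant and the noise has mean zero by the Bellman equation. Only
almost sure validity of `hQ'` is asked, since realizability holds only on the levels. -/
theorem integral_noise_smul (hφ : Measurable (fun p : S × A => φ p.1 p.2)) (hπ : Measurable π)
    (hφ1 : ∀ s a, ‖φ s a‖ ≤ 1) {h : ℕ}
    (hh : h ∈ Set.Icc 1 M.H) {μ : Measure (S × A)} [IsProbabilityMeasure μ]
    (hμ : ∀ᵐ p ∂μ, p.1 ∈ M.level h) {θ θ' : EuclideanSpace ℝ (Fin d)}
    (hQ : ∀ s ∈ M.level h, ∀ a, M.Q π h s a = inner ℝ (φ s a) θ)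
    (hQ' : ∀ s ∈ M.level h, ∀ a, ∀ᵐ s' ∂(M.P (s, a)),
      M.Q π (h + 1) s' (π s') = inner ℝ (φ s' (π s')) θ') :
    ∫ y, noise φ π θ θ' y • φ y.1.1 y.1.2 ∂(sampleLaw M μ) = 0 := by
  have hm : Measurable fun s => φ s (π s) := hφ.comp (measurable_id.prodMk hπ)
  have hint : Integrable (fun y => noise φ π θ θ' y • φ y.1.1 y.1.2) (sampleLaw M μ) :=
    Integrable.of_bound ((measurable_noise hφ hπ θ θ').smul
      (hφ.comp measurable_fst)).aestronglyMeasurable _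
      (ae_norm_noise_smul_le M hφ1 hh hμ (B := 1 + ‖θ‖ + ‖θ'‖)
        (by linarith [norm_nonneg θ, norm_nonneg θ']) (by linarith [norm_nonneg θ'])
        (by linarith [norm_nonneg θ]))
  rw [sampleLaw] at hint ⊢
  rw [Measure.integral_compProd hint]
  refine integral_eq_zero_of_ae ?_
  filter_upwards [hμ] with p hp
  simp only [Pi.zero_apply]
  rw [integral_smul_const, Kernel.prod_apply]
  have hR : Integrable (fun r : ℝ => r) (M.R p) := by
    refine Integrable.of_bound measurable_id.aestronglyMeasurable 1 ?_
    filter_upwards [M.reward_bound h hh p.1 hp p.2] with r hr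
    exact abs_le.2 hr
  have hP : Integrable (fun s' => inner ℝ (φ s' (π s')) θ') (M.P p) := by
    refine Integrable.of_bound (Measurable.aestronglyMeasurable (by fun_prop)) ‖θ'‖
      (ae_of_all _ fun s' => ?_)
    exact (norm_inner_le_norm _ _).trans (mul_le_of_le_one_left (norm_nonneg _) (hφ1 _ _))
  have h0 : ∫ q, noise φ π θ θ' (p, q) ∂((M.R p).prod (M.P p)) = 0 := by
    have hadd : Integrable (fun q : ℝ × S => q.1 + inner ℝ (φ q.2 (π q.2)) θ')
        ((M.R p).prod (M.P p)) := (hR.comp_fst _).add (hP.comp_snd _)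
    unfold noise
    dsimp only
    rw [integral_sub hadd (integrable_const _),
      integral_add (hR.comp_fst _) (hP.comp_snd _), integral_fun_fst (f := fun r : ℝ => r),
      integral_fun_snd (f := fun s' => inner ℝ (φ s' (π s')) θ'),
      ← integral_congr_ae (hQ' p.1 hp p.2)]
    simp only [probReal_univ, one_smul, integral_const]
    rw [← hQ p.1 hp p.2, M.Q_eq_integral_add hπ hh hp, sub_self]
  rw [h0, zero_smul]

end Population
-- Numerical estimates
section Rates

variable {C d H N L : ℝ}

theorem regularization_pos (hC : 0 < C) (hd : 1 ≤ d) (hH : 1 ≤ H) (hN : 1 ≤ N) (hL : 0 < L) :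
    0 < C * H * √(d * L * N) := by positivity

theorem sqrt_mul_deviation_le (hd : 1 ≤ d) (hN : 1 ≤ N) (hL : 0 < L) :
    √d * √(2 * N * (4 * L)) ≤ 3 * √(d * L * N) := by
  rw [← Real.sqrt_mul (by positivity)]
  refine Real.sqrt_le_iff.2 ⟨by positivity, ?_⟩
  rw [mul_pow, Real.sq_sqrt (by positivity)]
  have : 0 ≤ d * L * N := by positivity
  linarith

theorem inflation_le (hC : 0 < C) (hd : 1 ≤ d) (hH : 1 ≤ H) (hN : 1 ≤ N) (hL : 0 < L) :
    1 + 2 * (2 * √(2 * N * (4 * L))) / (C * H * √(d * L * N)) ≤ 1 + 12 / (C * H) := by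
  have h1 : √(2 * N * (4 * L)) ≤ 3 * √(d * L * N) :=
    (le_mul_of_one_le_left (Real.sqrt_nonneg _) (Real.one_le_sqrt.2 hd)).trans
      (sqrt_mul_deviation_le hd hN hL)
  have h2 : 0 < √(d * L * N) := by positivity
  gcongr 1 + ?_
  rw [div_le_div_iff₀ (by positivity) (by positivity)]
  nlinarith [mul_le_mul_of_nonneg_left h1 (by positivity : 0 ≤ 4 * (C * H))]

theorem inflation_pow_le (hC : 0 < C) {H : ℕ} (hH : 1 ≤ H) :
    (1 + 12 / (C * H)) ^ H ≤ Real.exp (12 / C) := by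
  have hH0 : (0 : ℝ) < H := by exact_mod_cast hH
  calc (1 + 12 / (C * H)) ^ H ≤ Real.exp (12 / (C * H)) ^ H := by
        gcongr
        linarith [Real.add_one_le_exp (12 / (C * H))]
    _ = _ := by
        rw [← Real.exp_nat_mul]
        congr 1
        field_simp

theorem level_error_sq_le (hC : 0 < C) (hd : 1 ≤ d) (hH : 1 ≤ H) (hN : 1 ≤ N) (hL : 0 < L) :
    (H * (√(C * H * √(d * L * N)) * (H * √d)
      + 3 * (H * √d) * √(2 * N * (4 * L)) / √(C * H * √(d * L * N)))) ^ 2 ≤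
    N * (C * (1 + 9 / C) ^ 2 * (d * H ^ 5) * √(d * L / N)) := by
  have hdev := sqrt_mul_deviation_le hd hN hL
  have hlam := regularization_pos hC hd hH hN hL
  have hσN : √(d * L * N) = N * √(d * L / N) := by
    rw [show d * L * N = N ^ 2 * (d * L / N) by field_simp, Real.sqrt_mul (by positivity),
      Real.sqrt_sq (by positivity)]
  set σ := √(d * L * N)
  set s := √(2 * N * (4 * L))
  set lam := C * H * σ with hlam'
  have hl : √lam ^ 2 = lam := Real.sq_sqrt hlam.le
  have hl0 : 0 < √lam := Real.sqrt_pos.2 hlam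
  have hd' : √d ^ 2 = d := Real.sq_sqrt (by positivity)
  -- The choice of `λ` makes the noise term at most `9 / C` times the bias bound.
  have h1 : 3 * (H * √d) * s / √lam ≤ 9 / C * (√lam * (H * √d)) := by
    have h2 : 1 ≤ H * √d := one_le_mul_of_one_le_of_one_le hH (Real.one_le_sqrt.2 hd)
    calc 3 * (H * √d) * s / √lam = 3 * H * (√d * s) / √lam := by ring
      _ ≤ 3 * H * (3 * σ) / √lam := by gcongr
      _ = 9 / C * √lam := by
          rw [div_eq_iff hl0.ne', mul_assoc (9 / C), ← sq, hl, hlam']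
          field_simp
          ring
      _ ≤ _ := by gcongr; exact le_mul_of_one_le_right hl0.le h2
  calc _ ≤ (H * (√lam * (H * √d) + 9 / C * (√lam * (H * √d)))) ^ 2 := by gcongr
    _ = H ^ 4 * √d ^ 2 * √lam ^ 2 * (1 + 9 / C) ^ 2 := by ring
    _ = _ := by rw [hd', hl, hlam', hσN]; ring

theorem failure_probability_le {δ : ℝ} (hδ : 0 < δ) (hd : 1 ≤ d) (hH : 1 ≤ H)
    (h2 : 2 ≤ d * H / δ) :
    H * (3 * (2 * Real.exp (-(4 * Real.log (d * H / δ))))) ≤ δ := by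
  have hpos : 0 < d * H / δ := by positivity
  have h1 : Real.exp (-(4 * Real.log (d * H / δ))) = ((d * H / δ)⁻¹) ^ 4 := by
    rw [← mul_neg, ← Real.log_inv, show (4 : ℝ) = ((4 : ℕ) : ℝ) by norm_num, Real.exp_nat_mul,
      Real.exp_log (by positivity)]
  set t := (d * H / δ)⁻¹ with ht
  have ht0 : 0 < t := by positivity
  have ht2 : t ≤ 2⁻¹ := inv_anti₀ two_pos h2
  have ht3 : t ^ 3 ≤ 2⁻¹ ^ 3 := pow_le_pow_left₀ ht0.le ht2 3
  have ht4 : d * H * t = δ := by rw [ht]; field_simp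
  -- One factor `t` pays for the union over the `H` levels, and the other three, at most `1/8`
  -- together, pay for the constant `6`.
  have hHt : H * t ≤ δ := by
    rw [← ht4]
    nlinarith [mul_pos (zero_lt_one.trans_le hH) ht0]
  rw [h1]
  calc H * (3 * (2 * t ^ 4)) = 6 * (H * t) * t ^ 3 := by ring
    _ ≤ 6 * δ * 2⁻¹ ^ 3 := by gcongr
    _ ≤ δ := by linarith

end Rates

theorem MDP.Q_eq_zero {S A : Type*} [MeasurableSpace S] [MeasurableSpace A] (M : MDP S A)
    (π : S → A) {h : ℕ} (hh : M.H < h) (s : S) (a : A) : M.Q π h s a = 0 := by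
  have h0 : M.H + 1 - h = 0 := by omega
  unfold MDP.Q
  rw [h0]
  simp

theorem ofReal_one_sub_le_of_compl_subset {Ω : Type*} [MeasurableSpace Ω] {Pr : Measure Ω}
    [IsProbabilityMeasure Pr] {good bad : Set Ω} {δ : ℝ} (hδ : 0 ≤ δ) (hbad : Pr.real bad ≤ δ)
    (h : badᶜ ⊆ good) : ENNReal.ofReal (1 - δ) ≤ Pr good := by
  rw [ENNReal.ofReal_sub _ hδ, ENNReal.ofReal_one, tsub_le_iff_right]
  calc 1 = Pr Set.univ := measure_univ.symm
    _ ≤ Pr (good ∪ bad) := measure_mono fun ω _ => by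
        by_cases hω : ω ∈ bad
        · exact Or.inr hω
        · exact Or.inl (h hω)
    _ ≤ Pr good + Pr bad := measure_union_le _ _
    _ ≤ _ := by
        gcongr
        exact (ENNReal.le_ofReal_iff_toReal_le (measure_ne_top _ _) hδ).2 hbad

end OfflineRL

/-! ### The main theorem -/

theorem theorem3 (C : ℝ) (hC : 0 < C) :
    ∃ c : ℝ, 0 < c ∧
      ∀ (S : Type u) (A : Type v) (Ω : Type w)
        [MeasurableSpace S] [MeasurableSpace A] [MeasurableSpace Ω]
        (Pr : Measure Ω) [IsProbabilityMeasure Pr]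
        (M : OfflineRL.MDP S A) (d N : ℕ)
        -- the features and the policy to be evaluated
        (φ : S → A → EuclideanSpace ℝ (Fin d)) (π : S → A)
        -- the data distributions, the shift coefficients, the confidence and the datasets
        (μ : ℕ → Measure (S × A)) (Cs : ℕ → ℝ) (δ : ℝ)
        (D : ℕ → Fin N → Ω → OfflineRL.Sample S A),
        1 ≤ d → 1 ≤ N → 0 < δ → δ < 1 → 2 ≤ d * M.H / δ →
        Measurable (fun p : S × A => φ p.1 p.2) → Measurable π →
        (∀ s a, ‖φ s a‖ ≤ 1) →
        (∀ h ∈ Set.Icc 1 M.H, IsProbabilityMeasure (μ h) ∧ ∀ᵐ p ∂(μ h), p.1 ∈ M.level h) →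
        -- for each level, the samples are i.i.d.
        (∀ h ∈ Set.Icc 1 M.H,
          (∀ i, Measurable (D h i) ∧ Pr.map (D h i) = OfflineRL.sampleLaw M (μ h)) ∧
          iIndepFun (D h) Pr) →
        -- realizability for the policy
        (∀ h ∈ Set.Icc 1 M.H, ∃ θ : EuclideanSpace ℝ (Fin d), ‖θ‖ ≤ M.H * √d ∧
          ∀ s ∈ M.level h, ∀ a, M.Q π h s a = inner ℝ (φ s a) θ) →
        -- low distribution shift
        (∀ h ∈ Set.Icc 1 M.H, 1 ≤ Cs h ∧
          (Cs h • OfflineRL.featCov φ (μ h) - OfflineRL.lookaheadCov M φ π μ h).PosSemidef) →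
        ENNReal.ofReal (1 - δ) ≤
          Pr {ω | (M.Q π 1 M.s₁ (π M.s₁)
              - OfflineRL.QHat φ π (C * M.H * √(d * Real.log (d * M.H / δ) * N)) M.H
                  (fun h i => D h i ω) 1 M.s₁ (π M.s₁)) ^ 2
            ≤ c * (∏ h ∈ Finset.Icc 1 M.H, Cs h) * (d * (M.H : ℝ) ^ 5)
                * √(d * Real.log (d * M.H / δ) / N)} := by
  refine ⟨C * (1 + 9 / C) ^ 2 * Real.exp (12 / C), by positivity, ?_⟩
  intro S A Ω _ _ _ Pr _ M d N φ π μ Cs δ D hd hN hδ0 hδ1 h2 hφ hπ hφ1 hμ hD hreal hshift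
  have hd' : (1 : ℝ) ≤ d := by exact_mod_cast hd
  have hN' : (1 : ℝ) ≤ N := by exact_mod_cast hN
  have hH' : (1 : ℝ) ≤ M.H := by exact_mod_cast M.H_pos
  set L := Real.log (d * M.H / δ) with hL'
  have hL : 0 < L := Real.log_pos (by linarith)
  set lam := C * M.H * √(d * L * N) with hlam'
  have hlam : 0 < lam := OfflineRL.regularization_pos hC hd' hH' hN' hL
  set B : ℝ := M.H * √d with hB'
  have hB : 1 ≤ B := one_le_mul_of_one_le_of_one_le hH' (Real.one_le_sqrt.2 hd')
  set s : ℝ := √(2 * N * (4 * L)) with hs'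
  -- Setting `θ h = 0` above `H` matches `V̂_{H+1} = 0` and lets level `H` be treated like the
  -- others.
  obtain ⟨θ, hθ⟩ : ∃ θ : ℕ → EuclideanSpace ℝ (Fin d), ∀ h, (‖θ h‖ ≤ B ∧
      (h ∈ Set.Icc 1 M.H → ∀ s ∈ M.level h, ∀ a, M.Q π h s a = inner ℝ (φ s a) (θ h))) ∧
      (M.H < h → θ h = 0) := by
    refine Classical.axiomOfChoice (r := fun h θ => (‖θ‖ ≤ B ∧
      (h ∈ Set.Icc 1 M.H → ∀ s ∈ M.level h, ∀ a, M.Q π h s a = inner ℝ (φ s a) θ)) ∧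
      (M.H < h → θ = 0)) fun h => ?_
    by_cases hh : h ∈ Set.Icc 1 M.H
    · obtain ⟨θ, h1, h3⟩ := hreal h hh
      exact ⟨θ, ⟨h1, fun _ => h3⟩, fun h4 => absurd hh.2 (not_le.2 h4)⟩
    · exact ⟨0, ⟨by simpa using zero_le_one.trans hB, fun h1 => absurd h1 hh⟩, fun _ => rfl⟩
  let f : OfflineRL.Sample S A → EuclideanSpace ℝ (Fin d) := fun y => φ y.1.1 y.1.2
  let f' : OfflineRL.Sample S A → EuclideanSpace ℝ (Fin d) := fun y => φ y.2.2 (π y.2.2)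
  have hf : Measurable f := hφ.comp measurable_fst
  have hf' : Measurable f' :=
    hφ.comp ((measurable_id.prodMk hπ).comp (measurable_snd.comp measurable_snd))
  let dev : (OfflineRL.Sample S A → EuclideanSpace ℝ (Fin d)) → ℕ → Set Ω := fun g h =>
    {ω | ∃ v, 2 * s * ‖v‖ ^ 2 < |∑ i, inner ℝ (g (D h i ω)) v ^ 2
      - N * ∫ y, inner ℝ (g y) v ^ 2 ∂(OfflineRL.sampleLaw M (μ h))|}
  let n : ℕ → OfflineRL.Sample S A → ℝ := fun h => OfflineRL.noise φ π (θ h) (θ (h + 1))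
  let devn : ℕ → Set Ω := fun h => {ω | 3 * B * s ≤ ‖∑ i, n h (D h i ω) • f (D h i ω)‖}
  -- Three failure events per level: the covariance of the features, that of the lookahead features,
  -- and the noise. Each has probability at most `2 * exp (-4L)`.
  let bad : Set Ω := ⋃ h ∈ Finset.Icc 1 M.H, (dev f h ∪ dev f' h ∪ devn h)
  have hlevel : ∀ h ∈ Finset.Icc 1 M.H,
      Pr.real (dev f h ∪ dev f' h ∪ devn h) ≤ 3 * (2 * Real.exp (-(4 * L))) := by
    intro h hh
    rw [Finset.mem_Icc] at hh
    have hh : h ∈ Set.Icc 1 M.H := hh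
    have := (hμ h hh).1
    have h4L : 0 ≤ 4 * L := by positivity
    have e1 := OfflineRL.measure_quadratic_dev_le hN (hD h hh).1 (hD h hh).2 hf
      (fun y => hφ1 _ _) h4L
    have e2 := OfflineRL.measure_quadratic_dev_le hN (hD h hh).1 (hD h hh).2 hf'
      (fun y => hφ1 _ _) h4L
    have e3 := OfflineRL.measure_iid_norm_sum_ge_le hN (hD h hh).1 (hD h hh).2
      (g := fun y => n h y • f y) ((OfflineRL.measurable_noise hφ hπ _ _).smul hf)
      (b := 3 * B) (by positivity)
      (OfflineRL.ae_norm_noise_smul_le M hφ1 hh (hμ h hh).2 hB (hθ h).1.1 (hθ (h + 1)).1.1)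
      (OfflineRL.integral_noise_smul M hφ hπ hφ1 hh (hμ h hh).2 ((hθ h).1.2 hh) (by
        intro s hs a
        rcases hh.2.eq_or_lt with he | hlt
        · refine Filter.Eventually.of_forall fun s' => ?_
          rw [M.Q_eq_zero π (by omega), (hθ (h + 1)).2 (by omega), inner_zero_right]
        · filter_upwards [M.level_step h hh.1 hlt s hs a] with s' hs'
          exact (hθ (h + 1)).1.2 ⟨by omega, hlt⟩ s' hs' _)) h4L
    have u1 := measureReal_union_le (μ := Pr) (dev f h ∪ dev f' h) (devn h)
    have u2 := measureReal_union_le (μ := Pr) (dev f h) (dev f' h)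
    change Pr.real (dev f h) ≤ _ at e1
    change Pr.real (dev f' h) ≤ _ at e2
    change Pr.real (devn h) ≤ _ at e3
    linarith
  have hbad : Pr.real bad ≤ δ := by
    refine (measureReal_biUnion_finset_le _ _).trans ((Finset.sum_le_sum hlevel).trans ?_)
    rw [Finset.sum_const, Nat.card_Icc, Nat.add_sub_cancel, nsmul_eq_mul]
    exact OfflineRL.failure_probability_le hδ0 hd' hH' h2
  refine OfflineRL.ofReal_one_sub_le_of_compl_subset hδ0.le hbad fun ω hω => ?_
  have hgood : ∀ h ∈ Set.Icc 1 M.H, ω ∉ dev f h ∧ ω ∉ dev f' h ∧ ω ∉ devn h := by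
    intro h hh
    simp only [bad, Set.mem_compl_iff, Set.mem_iUnion, not_exists] at hω
    have := hω h (Finset.mem_Icc.2 hh)
    simp only [Set.mem_union, not_or] at this
    exact ⟨this.1.1, this.1.2, this.2⟩
  set θ' := OfflineRL.thetaHat φ π lam M.H (fun h i => D h i ω) with hθ'
  have hs0 : 0 ≤ s := Real.sqrt_nonneg _
  have main := OfflineRL.lookahead_error_le M.H_pos (f := fun h i => f (D h i ω))
    (f' := fun h i => f' (D h i ω)) (z := fun h => θ h - θ' h)
    (q := fun h v => ∫ y, inner ℝ (f y) v ^ 2 ∂(OfflineRL.sampleLaw M (μ h)))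
    (q' := fun h v => v.ofLp ⬝ᵥ (OfflineRL.lookaheadCov M φ π μ h *ᵥ v.ofLp)) (Cs := Cs)
    (r := 2 * s) (a := √lam * B + 3 * B * s / √lam) hlam (by positivity) (by positivity)
    (OfflineRL.inflation_le hC hd' hH' hN' hL)
    (fun h hh => by
      refine (OfflineRL.sqrt_energy_sub_le hlam (n := fun i => n h (D h i ω))
        (x := fun i => inner ℝ (f' (D h i ω)) (θ (h + 1) - θ' (h + 1))) ?_).trans ?_
      · refine (OfflineRL.thetaHat_normal_eq φ π hlam hh.2 fun h i => D h i ω).trans ?_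
        refine Finset.sum_congr rfl fun i _ => ?_
        congr 1
        simp only [n, OfflineRL.noise, f, f', inner_sub_right]
        ring
      · have : ‖∑ i, n h (D h i ω) • f (D h i ω)‖ ≤ 3 * B * s :=
          (not_le.1 fun hle => (hgood h hh).2.2 hle).le
        gcongr
        exact (hθ h).1.1)
    (by rw [(hθ _).2 (by omega), hθ', OfflineRL.thetaHat_eq_zero _ _ _ (by omega), sub_zero])
    (fun h hh v => not_lt.1 fun hlt => (hgood h hh).1 ⟨v, hlt⟩)
    (fun h h1 hlt v => by
      have hh : h ∈ Set.Icc 1 M.H := ⟨h1, hlt.le⟩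
      have := (hμ h hh).1
      rw [OfflineRL.dotProduct_lookaheadCov_succ_mulVec M hφ hπ hφ1 μ h1]
      exact not_lt.1 fun hlt => (hgood h hh).2.1 ⟨v, hlt⟩)
    (fun h hh => ⟨(hshift h hh).1, fun v => by
      have := (hμ h hh).1
      have hpsd := (hshift h hh).2.dotProduct_mulVec_nonneg v.ofLp
      rw [star_trivial, Matrix.sub_mulVec, Matrix.smul_mulVec, dotProduct_sub, dotProduct_smul,
        smul_eq_mul, OfflineRL.dotProduct_featCov_mulVec M hφ hφ1] at hpsd
      exact sub_nonneg.1 hpsd⟩)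
  have h1mem : 1 ∈ Set.Icc 1 M.H := ⟨le_rfl, M.H_pos⟩
  rw [OfflineRL.dotProduct_lookaheadCov_one_mulVec] at main
  have hP : 0 ≤ ∏ h ∈ Finset.Icc 1 M.H, Cs h :=
    Finset.prod_nonneg fun h hh => zero_le_one.trans (hshift h (Finset.mem_Icc.1 hh)).1
  rw [Set.mem_ofPred_eq, (hθ 1).1.2 h1mem _ M.s₁_mem, OfflineRL.QHat, ← inner_sub_right]
  have hN0 : (0 : ℝ) < N := by positivity
  -- The lookahead form at level `1` is exactly the squared prediction error at `s₁`, so only the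
  -- factor `N` is left to cancel.
  refine le_of_mul_le_mul_left (main.trans ?_) hN0
  calc _ ≤ (∏ h ∈ Finset.Icc 1 M.H, Cs h) * Real.exp (12 / C) *
        (N * (C * (1 + 9 / C) ^ 2 * (d * (M.H : ℝ) ^ 5) * √(d * L / N))) := by
        gcongr
        · exact OfflineRL.inflation_pow_le hC M.H_pos
        · exact OfflineRL.level_error_sq_le hC hd' hH' hN' hL
    _ = _ := by ring
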